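/- Let $R$ be a commutative Noetherian ring, $I$ an ideal of $R$, and $M,N$ finitely generated $R$-modules. For $R$-modules $X,Y$ and $i\ge 0$ put $$H^i_I(X,Y)=\varinjlim_{q}\operatorname{Ext}^i_R(X/I^qX,\,Y),\qquad H^i_I(Y)=H^i_I(R,Y),$$ the direct system being induced by the natural surjections $X/I^{q+1}X\to X/I^qX$. Define $$\operatorname{depth}_I(X,Y)=\inf\{i\ge 0\mid H^i_I(X,Y)\ne 0\},\qquad \operatorname{cd}_I(X,Y)=\sup\{i\ge 0\mid H^i_I(X,Y)\ne 0\},$$ $$\operatorname{depth}_I Y=\inf\{i\ge 0\mid H^i_I(Y)\ne 0\},\qquad \operatorname{cd}_I Y=\sup\{i\ge 0\mid H^i_I(Y)\ne 0\},$$ $$e_R(X,Y)=\sup\{i\ge 0\mid \operatorname{Ext}^i_R(X,Y)\ne 0\},\qquad h_I(X,Y)=\sup_{q\ge 0} e_R(X,H^q_I(Y)),$$ with values in $\{-\infty\}\cup\mathbb{N}\cup\{\infty\}$, where $\inf\emptyset=\infty$, $\sup\emptyset=-\infty$, and a sum with a summand $-\infty$ is $-\infty$. Then $$\operatorname{depth}_I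 N\le \operatorname{depth}_I(M,N),\qquad \operatorname{cd}_I(M,N)\le \min\{\operatorname{cd}_I(M\otimes_R N)+e_R(M,N),\ \operatorname{cd}_I N+h_I(M,N)\},$$ and, provided that $H^i_I(M,N)\neq 0$ for at least one $i\ge 0$, also $\operatorname{depth}_I(M,N)\le \operatorname{cd}_I(M,N)$, so that $$\operatorname{depth}_I N\le \operatorname{depth}_I(M,N)\le \operatorname{cd}_I(M,N)\le \min\{\operatorname{cd}_I(M\otimes_R N)+e_R(M,N),\ \operatorname{cd}_I N+h_I(M,N)\}.$$ -/

import Mathlib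

universe u

open CategoryTheory TensorProduct

noncomputable section

namespace GenLocalCohomology

variable {R : Type u} [CommRing R]

/-- The `R`-module `Ext^i_R(M, N)`. -/
abbrev ExtModule (R : Type u) [CommRing R] (M N : Type u) [AddCommGroup M] [Module R M]
    [AddCommGroup N] [Module R N] (i : ℕ) : Type u :=
  Abelian.Ext.{u} (ModuleCat.of R M) (ModuleCat.of R N) i

section Modules

variable (I : Ideal R) (M N : Type u) [AddCommGroup M] [Module R M] [AddCommGroup N] [Module R N]

/-- The map `Ext^i_R(M / I^p M, N) → Ext^i_R(M / I^q M, N)`, for `p ≤ q`, induced by the natural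
surjection `M / I^q M → M / I^p M`. -/
def transition (i : ℕ) (p q : ℕ) (h : p ≤ q) :
    ExtModule R (M ⧸ (I ^ p • ⊤ : Submodule R M)) N i →ₗ[R]
      ExtModule R (M ⧸ (I ^ q • ⊤ : Submodule R M)) N i :=
  (Abelian.Ext.mk₀ (ModuleCat.ofHom (Submodule.factorPow I M h))).precompOfLinear R
    (ModuleCat.of R N) (zero_add i)

instance transition_directedSystem (i : ℕ) :
    DirectedSystem (fun q : ℕ => ExtModule R (M ⧸ (I ^ q • ⊤ : Submodule R M)) N i)
      (transition I M N i · · ·) where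
  map_self q x := by
    have h : ModuleCat.ofHom (Submodule.factorPow I M (le_refl q)) = 𝟙 _ := by
      ext x
      rfl
    change (Abelian.Ext.mk₀ (ModuleCat.ofHom (Submodule.factorPow I M (le_refl q)))).comp x
      (zero_add i) = x
    rw [h, Abelian.Ext.mk₀_id_comp]
  map_map k j i' hij hjk x := by
    have h : ModuleCat.ofHom (Submodule.factorPow I M (hij.trans hjk)) =
        ModuleCat.ofHom (Submodule.factorPow I M hjk) ≫
          ModuleCat.ofHom (Submodule.factorPow I M hij) := by
      ext x
      rfl
    change (Abelian.Ext.mk₀ (ModuleCat.ofHom (Submodule.factorPow I M hjk))).comp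
      ((Abelian.Ext.mk₀ (ModuleCat.ofHom (Submodule.factorPow I M hij))).comp x (zero_add i))
      (zero_add i) = (Abelian.Ext.mk₀ (ModuleCat.ofHom
        (Submodule.factorPow I M (hij.trans hjk)))).comp x (zero_add i)
    rw [h, Abelian.Ext.mk₀_comp_mk₀_assoc]

/-- The generalized local cohomology module
`H^i_I(M, N) = colim_q Ext^i_R(M / I^q M, N)`. -/
abbrev genLocalCohomology (i : ℕ) : Type u :=
  Module.DirectLimit (fun q : ℕ => ExtModule R (M ⧸ (I ^ q • ⊤ : Submodule R M)) N i)
    (transition I M N i)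

/-- The local cohomology module `H^i_I(N) = H^i_I(R, N) = colim_q Ext^i_R(R / I^q, N)`. -/
abbrev locCohomology (i : ℕ) : Type u :=
  genLocalCohomology I R N i

/-- `depth_I(M, N) = inf {i ≥ 0 | H^i_I(M, N) ≠ 0}`; the infimum of the empty set is `∞`. -/
def depthPair : WithBot ℕ∞ :=
  ⨅ (i : ℕ) (_ : Nontrivial (genLocalCohomology I M N i)), ((i : ℕ∞) : WithBot ℕ∞)

/-- `cd_I(M, N) = sup {i ≥ 0 | H^i_I(M, N) ≠ 0}`; the supremum of the empty set is `-∞`. -/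
def cdPair : WithBot ℕ∞ :=
  ⨆ (i : ℕ) (_ : Nontrivial (genLocalCohomology I M N i)), ((i : ℕ∞) : WithBot ℕ∞)

/-- `depth_I N = inf {i ≥ 0 | H^i_I(N) ≠ 0}`; the infimum of the empty set is `∞`. -/
def depth : WithBot ℕ∞ :=
  ⨅ (i : ℕ) (_ : Nontrivial (locCohomology I N i)), ((i : ℕ∞) : WithBot ℕ∞)

/-- `cd_I N = sup {i ≥ 0 | H^i_I(N) ≠ 0}`; the supremum of the empty set is `-∞`. -/
def cd : WithBot ℕ∞ :=
  ⨆ (i : ℕ) (_ : Nontrivial (locCohomology I N i)), ((i : ℕ∞) : WithBot ℕ∞)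

/-- `e_R(M, N) = sup {i ≥ 0 | Ext^i_R(M, N) ≠ 0}`; the supremum of the empty set is `-∞`. -/
def extSup (R : Type u) [CommRing R] (M N : Type u) [AddCommGroup M] [Module R M]
    [AddCommGroup N] [Module R N] : WithBot ℕ∞ :=
  ⨆ (i : ℕ) (_ : Nontrivial (ExtModule R M N i)), ((i : ℕ∞) : WithBot ℕ∞)

/-- `h_I(M, N) = sup_{q ≥ 0} e_R(M, H^q_I(N))`. -/
def hSup : WithBot ℕ∞ :=
  ⨆ q : ℕ, extSup R M (locCohomology I N q)

end Modules

end GenLocalCohomology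

end

noncomputable section

namespace GenLocalCohomology

/-! ### Cohomological sequences of functors and vanishing for composites -/

section

variable {R : Type u} [CommRing R]

/-! Both upper bounds come from spectral sequences converging to H^{p+q}_I(M,N), with terms Ext^p(M,
H^q_I(N)) and H^p_I(Ext^q(M,N)): if the limit is nonzero in degree n, some term with p + q = n is
nonzero. Only this consequence is needed, and `subsingleton_of_composite` obtains it by dimension
shifting along embeddings into injectives. Its acyclicity inputs are that Γ_I preserves injectives
(Artin–Rees) and that Hom(M,E) is Γ_I-acyclic for E injective.

The first sequence gives cd_I N + h_I(M,N) at once. For the second, Ext^q(M,N) is finitely generated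
with support inside Supp(M ⊗ N), so it remains to see that cd_I of finitely generated modules is
monotone in the support (`subsingleton_locCohomology_of_support_subset`). That is a descending
induction on the degree through prime filtrations, started by a uniform bound on the degrees in
which H_I can be nonzero.

For the lower bound, if H^j_I(N) = 0 for all j ≤ i, then Ext^i(L,N) = 0 for every finitely generated
L killed by a power of I. Taking L = M/I^qM and passing to the limit gives H^i_I(M,N) = 0. -/

/-- A short exact sequence in `ModuleCat` from an exact sequence of linear maps. -/
theorem shortExact_of_linearMap {A B C : Type u} [AddCommGroup A] [Module R A]
    [AddCommGroup B] [Module R B] [AddCommGroup C] [Module R C] (f : A →ₗ[R] B) (g : B →ₗ[R] C)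
    (hf : Function.Injective f) (hg : Function.Surjective g) (h : Function.Exact f g) :
    (ShortComplex.mk (ModuleCat.ofHom f) (ModuleCat.ofHom g)
      (by rw [← ModuleCat.ofHom_comp, h.linearMap_comp_eq_zero]; rfl)).ShortExact where
  exact := (ShortComplex.ShortExact.moduleCat_exact_iff_function_exact _).2 h
  mono_f := (ModuleCat.mono_iff_injective _).2 hf
  epi_g := (ModuleCat.epi_iff_surjective _).2 hg

/-- A sequence of functors on `R`-modules having long exact sequences which start with `0 → F⁰`
(no naturality of the connecting maps is required). -/
structure IsCohomological (F : ℕ → ModuleCat.{u} R ⥤ ModuleCat.{u} R) : Prop where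
  injective : ∀ {S : ShortComplex (ModuleCat.{u} R)}, S.ShortExact →
    Function.Injective ((F 0).map S.f).hom
  exact_middle : ∀ {S : ShortComplex (ModuleCat.{u} R)}, S.ShortExact → ∀ i,
    Function.Exact ((F i).map S.f).hom ((F i).map S.g).hom
  exists_connecting : ∀ {S : ShortComplex (ModuleCat.{u} R)}, S.ShortExact → ∀ i,
    ∃ δ : (F i).obj S.X₃ →ₗ[R] (F (i + 1)).obj S.X₁,
      Function.Exact ((F i).map S.g).hom δ ∧ Function.Exact δ ((F (i + 1)).map S.f).hom

/-- The positive degree functors vanish on injective modules. -/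
def VanishesOnInjectives (F : ℕ → ModuleCat.{u} R ⥤ ModuleCat.{u} R) : Prop :=
  ∀ (E : ModuleCat.{u} R), Injective E → ∀ i, Subsingleton ((F (i + 1)).obj E)

theorem subsingleton_obj_of_linearEquiv (F : ModuleCat.{u} R ⥤ ModuleCat.{u} R)
    {A B : ModuleCat.{u} R} (e : A ≃ₗ[R] B) [Subsingleton (F.obj B)] :
    Subsingleton (F.obj A) :=
  (F.mapIso e.toModuleIso).toLinearEquiv.toEquiv.subsingleton

theorem exists_injective_shortExact (N : ModuleCat.{u} R) :
    ∃ (E C : ModuleCat.{u} R) (f : N ⟶ E) (g : E ⟶ C) (w : f ≫ g = 0),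
      Injective E ∧ (ShortComplex.mk f g w).ShortExact := by
  let f : N →ₗ[R] (Injective.under N : ModuleCat.{u} R) := (Injective.ι N).hom
  have hf : Function.Injective f := (ModuleCat.mono_iff_injective (Injective.ι N)).1 inferInstance
  exact ⟨Injective.under N,
    ModuleCat.of R ((Injective.under N : ModuleCat.{u} R) ⧸ LinearMap.range f), Injective.ι N,
    ModuleCat.ofHom (LinearMap.range f).mkQ, _, inferInstance,
    shortExact_of_linearMap f (LinearMap.range f).mkQ hf (Submodule.mkQ_surjective _)
      (LinearMap.exact_map_mkQ_range f)⟩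

namespace IsCohomological

variable {F : ℕ → ModuleCat.{u} R ⥤ ModuleCat.{u} R} (hF : IsCohomological F)
  {S : ShortComplex (ModuleCat.{u} R)} (hS : S.ShortExact)
include hF hS

theorem subsingleton_X₂ (i : ℕ) [Subsingleton ((F i).obj S.X₁)]
    [Subsingleton ((F i).obj S.X₃)] : Subsingleton ((F i).obj S.X₂) :=
  subsingleton_of_forall_eq 0 fun x => by
    obtain ⟨y, rfl⟩ := (hF.exact_middle hS i x).1 (Subsingleton.elim _ _)
    rw [Subsingleton.elim y 0, map_zero]

theorem subsingleton_X₃ (i : ℕ) [Subsingleton ((F i).obj S.X₂)]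
    [Subsingleton ((F (i + 1)).obj S.X₁)] : Subsingleton ((F i).obj S.X₃) := by
  obtain ⟨δ, h, -⟩ := hF.exists_connecting hS i
  refine subsingleton_of_forall_eq 0 fun x => ?_
  obtain ⟨y, rfl⟩ := (h x).1 (Subsingleton.elim _ _)
  rw [Subsingleton.elim y 0, map_zero]

theorem surjective_map_g (i : ℕ) [Subsingleton ((F (i + 1)).obj S.X₁)] :
    Function.Surjective ((F i).map S.g).hom := fun x => by
  obtain ⟨δ, h, -⟩ := hF.exists_connecting hS i
  exact (h x).1 (Subsingleton.elim _ _)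

theorem subsingleton_X₁_of_surjective (i : ℕ) (h : Function.Surjective ((F i).map S.g).hom)
    [Subsingleton ((F (i + 1)).obj S.X₂)] : Subsingleton ((F (i + 1)).obj S.X₁) := by
  obtain ⟨δ, h₁, h₂⟩ := hF.exists_connecting hS i
  refine subsingleton_of_forall_eq 0 fun x => ?_
  obtain ⟨y, rfl⟩ := (h₂ x).1 (Subsingleton.elim _ _)
  exact (h₁ y).2 (h y)

theorem subsingleton_X₁ (i : ℕ) [Subsingleton ((F i).obj S.X₃)]
    [Subsingleton ((F (i + 1)).obj S.X₂)] : Subsingleton ((F (i + 1)).obj S.X₁) :=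
  hF.subsingleton_X₁_of_surjective hS i fun _ => ⟨0, Subsingleton.elim _ _⟩

theorem surjective_map_f (i : ℕ) [Subsingleton ((F i).obj S.X₃)] :
    Function.Surjective ((F i).map S.f).hom := fun x =>
  (hF.exact_middle hS i x).1 (Subsingleton.elim _ _)

theorem exists_linearEquiv (i : ℕ) [Subsingleton ((F i).obj S.X₂)]
    [Subsingleton ((F (i + 1)).obj S.X₂)] :
    Nonempty ((F i).obj S.X₃ ≃ₗ[R] (F (i + 1)).obj S.X₁) := by
  obtain ⟨δ, h₁, h₂⟩ := hF.exists_connecting hS i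
  refine ⟨LinearEquiv.ofBijective δ ⟨?_, fun x => (h₂ x).1 (Subsingleton.elim _ _)⟩⟩
  refine (injective_iff_map_eq_zero δ).2 fun x hx => ?_
  obtain ⟨y, rfl⟩ := (h₁ x).1 hx
  rw [Subsingleton.elim y 0, map_zero]

end IsCohomological

/-- A vanishing form of the Grothendieck spectral sequence `T^p G^q N ⇒ K^{p+q} N`. -/
theorem subsingleton_of_composite {T G K : ℕ → ModuleCat.{u} R ⥤ ModuleCat.{u} R}
    (hT : IsCohomological T) (hG : IsCohomological G) (hK : IsCohomological K)
    (hG' : VanishesOnInjectives G) (hK' : VanishesOnInjectives K)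
    (hTG : ∀ (E : ModuleCat.{u} R), Injective E → ∀ p, Subsingleton ((T (p + 1)).obj ((G 0).obj E)))
    (e : G 0 ⋙ T 0 ≅ K 0) (n : ℕ) (N : ModuleCat.{u} R)
    (h : ∀ p q, p + q = n → Subsingleton ((T p).obj ((G q).obj N))) :
    Subsingleton ((K n).obj N) := by
  induction n generalizing N with
  | zero =>
    have : Subsingleton ((G 0 ⋙ T 0).obj N) := h 0 0 rfl
    exact (e.app N).toLinearEquiv.toEquiv.symm.subsingleton
  | succ n ih =>
    obtain ⟨E, C, f, g, w, hE, hS⟩ := exists_injective_shortExact N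
    have := hK' E hE
    have := hG' E hE
    have := hTG E hE
    obtain ⟨δ, hδ₁, hδ₂⟩ := hG.exists_connecting hS 0
    let g₀ : (G 0).obj E →ₗ[R] (G 0).obj C := ((G 0).map g).hom
    -- With B the image of G⁰E → G⁰C, the sequence 0 → G⁰N → G⁰E → G⁰C → G¹N → 0 splits into 0 → G⁰N
    -- → G⁰E → B → 0 and 0 → B → G⁰C → G¹N → 0.
    have hB := shortExact_of_linearMap ((G 0).map f).hom g₀.rangeRestrict (hG.injective hS)
      g₀.surjective_rangeRestrict (fun x => by
        rw [← hG.exact_middle hS 0 x, ← Submodule.coe_eq_zero]; rfl)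
    have hC := shortExact_of_linearMap (LinearMap.range g₀).subtype δ
      (LinearMap.range g₀).injective_subtype
      (fun x => (hδ₂ x).1 (Subsingleton.elim _ _)) (fun x => by
        rw [hδ₁ x, Submodule.coe_subtype, Subtype.range_coe_subtype]; rfl)
    have h₁ := h (n + 1) 0 rfl
    have h₂ := h n 1 rfl
    cases n with
    | zero =>
      -- K⁰E need not vanish, so K¹N is not a shift of K⁰C; it is the cokernel of K⁰E → K⁰C.
      -- Vanishing of T¹G⁰N and T⁰G¹N makes T⁰G⁰E → T⁰B → T⁰G⁰C surjective.
      refine hK.subsingleton_X₁_of_surjective hS 0 ?_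
      have s : Function.Surjective ((T 0).map ((G 0).map g)).hom := by
        have s₁ := hT.surjective_map_g hB 0
        have s₂ := hT.surjective_map_f hC 0
        have := s₂.comp s₁
        rwa [← LinearMap.coe_comp, ← ModuleCat.hom_comp, ← Functor.map_comp] at this
      have hn : (e.app E).inv ≫ (T 0).map ((G 0).map g) ≫ (e.app C).hom = (K 0).map g := by
        rw [Iso.inv_comp_eq]
        exact e.hom.naturality g
      change Function.Surjective ((K 0).map g).hom
      rw [← hn]
      exact ((e.app C).toLinearEquiv.surjective.comp s).comp (e.app E).symm.toLinearEquiv.surjective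
    | succ n =>
      have : Subsingleton ((K (n + 1)).obj C) := by
        refine ih C fun p q hpq => ?_
        cases q with
        | zero =>
          obtain rfl : p = n + 1 := hpq
          -- T^{n+1}B lies between T^{n+1}G⁰E = 0 and T^{n+2}G⁰N = 0.
          have := hT.subsingleton_X₃ hB (n + 1)
          exact hT.subsingleton_X₂ hC (n + 1)
        | succ q =>
          obtain ⟨i⟩ := hG.exists_linearEquiv hS (q + 1)
          have := h p (q + 1 + 1) (by omega)
          exact subsingleton_obj_of_linearEquiv (T p) i
      exact hK.subsingleton_X₁ hS (n + 1)

end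

/-! ### The functors Γ_I, Hom, Ext and H_I(M, -) -/

section

variable {R : Type u} [CommRing R]

/-- The submodule `Γ_I(X)` of elements annihilated by a power of `I`. -/
def gamma (I : Ideal R) (X : Type u) [AddCommGroup X] [Module R X] : Submodule R X where
  carrier := {x | ∃ q : ℕ, ∀ r ∈ I ^ q, r • x = 0}
  zero_mem' := ⟨0, fun _ _ => smul_zero _⟩
  add_mem' := by
    rintro x y ⟨p, hp⟩ ⟨q, hq⟩
    exact ⟨p + q, fun r hr => by
      rw [smul_add, hp r (Ideal.pow_le_pow_right (Nat.le_add_right p q) hr),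
        hq r (Ideal.pow_le_pow_right (Nat.le_add_left q p) hr), add_zero]⟩
  smul_mem' := by
    rintro c x ⟨q, hq⟩
    exact ⟨q, fun r hr => by rw [smul_comm, hq r hr, smul_zero]⟩

section

variable (I : Ideal R) {X Y : Type u} [AddCommGroup X] [Module R X] [AddCommGroup Y] [Module R Y]

theorem map_mem_gamma (f : X →ₗ[R] Y) {x : X} (hx : x ∈ gamma I X) : f x ∈ gamma I Y := by
  obtain ⟨q, hq⟩ := hx
  exact ⟨q, fun r hr => by rw [← map_smul, hq r hr, map_zero]⟩

/-- Finitely many generators share one exponent. Finiteness of M enters the degree zero comparisons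
through this uniformity. -/
theorem exists_pow_smul_eq_zero [Module.Finite R X] (f : X →ₗ[R] Y) (hf : ∀ x, f x ∈ gamma I Y) :
    ∃ q : ℕ, ∀ r ∈ I ^ q, ∀ x, r • f x = 0 := by
  obtain ⟨s, hs⟩ := Module.Finite.fg_top (R := R) (M := X)
  choose q hq using hf
  refine ⟨s.sup q, fun r hr x => ?_⟩
  have h : (⊤ : Submodule R X) ≤ LinearMap.ker (r • f) := by
    rw [← hs, Submodule.span_le]
    exact fun y hy => hq y r (Ideal.pow_le_pow_right (Finset.le_sup hy) hr)
  exact h (Submodule.mem_top (x := x))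

end

/-- The functor `Γ_I`. -/
def gammaFunctor (I : Ideal R) : ModuleCat.{u} R ⥤ ModuleCat.{u} R where
  obj X := ModuleCat.of R (gamma I X)
  map f := ModuleCat.ofHom (f.hom.restrict fun _ hx => map_mem_gamma I f.hom hx)

/-- The functor `Hom_R(M, -)`. -/
def homFunctor (M : Type u) [AddCommGroup M] [Module R M] :
    ModuleCat.{u} R ⥤ ModuleCat.{u} R where
  obj X := ModuleCat.of R (M →ₗ[R] X)
  map f := ModuleCat.ofHom (f.hom.compRight R)

/-- The functors `Ext^i_R(M, -)`. -/
def extFunctor (M : Type u) [AddCommGroup M] [Module R M] (i : ℕ) :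
    ModuleCat.{u} R ⥤ ModuleCat.{u} R where
  obj N := ModuleCat.of R (ExtModule R M N i)
  map f := ModuleCat.ofHom ((Abelian.Ext.mk₀ f).postcompOfLinear R (ModuleCat.of R M) (add_zero i))
  map_id N := by
    ext x
    exact Abelian.Ext.comp_mk₀_id x
  map_comp f g := by
    ext x
    refine .trans ?_ (Abelian.Ext.comp_assoc_of_third_deg_zero x (Abelian.Ext.mk₀ f)
      (Abelian.Ext.mk₀ g) (add_zero i)).symm
    rw [Abelian.Ext.mk₀_comp_mk₀]
    rfl

/-- The connecting map is kept explicit, as the product with the extension class, because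
compatibility with the transition maps is needed to pass to the limit. -/
theorem exact_postcomp_extClass (M : Type u) [AddCommGroup M] [Module R M]
    {S : ShortComplex (ModuleCat.{u} R)} (hS : S.ShortExact) (i : ℕ) :
    Function.Exact ((extFunctor M i).map S.g).hom
      (hS.extClass.postcompOfLinear R (ModuleCat.of R M) (rfl : i + 1 = i + 1)) ∧
    Function.Exact (hS.extClass.postcompOfLinear R (ModuleCat.of R M) (rfl : i + 1 = i + 1))
      ((extFunctor M (i + 1)).map S.f).hom := by
  refine ⟨fun x => ⟨fun h =>
    Abelian.Ext.covariant_sequence_exact₃ _ hS x rfl h, ?_⟩, fun x => ⟨fun h =>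
    Abelian.Ext.covariant_sequence_exact₁ _ hS x h rfl, ?_⟩⟩
  · rintro ⟨y, rfl⟩
    refine (Abelian.Ext.comp_assoc_of_second_deg_zero y (Abelian.Ext.mk₀ S.g)
      hS.extClass rfl).trans ?_
    rw [hS.comp_extClass]
    exact Abelian.Ext.comp_zero _ _ _ _ _
  · rintro ⟨y, rfl⟩
    refine (Abelian.Ext.comp_assoc_of_third_deg_zero y hS.extClass (Abelian.Ext.mk₀ S.f)
      rfl).trans ?_
    rw [hS.extClass_comp]
    exact Abelian.Ext.comp_zero _ _ _ _ _

theorem isCohomological_extFunctor (M : Type u) [AddCommGroup M] [Module R M] :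
    IsCohomological (extFunctor (R := R) M) where
  injective hS := by
    have := hS.mono_f
    exact Abelian.Ext.postcomp_mk₀_injective_of_mono (ModuleCat.of R M) _
  exact_middle {S} hS i x := by
    refine ⟨fun h => Abelian.Ext.covariant_sequence_exact₂ _ hS x h, ?_⟩
    rintro ⟨y, rfl⟩
    refine (Abelian.Ext.comp_assoc_of_third_deg_zero y (Abelian.Ext.mk₀ S.f)
      (Abelian.Ext.mk₀ S.g) (add_zero i)).trans ?_
    rw [Abelian.Ext.mk₀_comp_mk₀, S.zero, Abelian.Ext.mk₀_zero]
    exact Abelian.Ext.comp_zero _ _ _ _ _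
  exists_connecting {S} hS i := ⟨_, exact_postcomp_extClass M hS i⟩



theorem vanishesOnInjectives_extFunctor (M : Type u) [AddCommGroup M] [Module R M] :
    VanishesOnInjectives (extFunctor (R := R) M) := fun _ _ i =>
  subsingleton_of_forall_eq 0 fun x => Abelian.Ext.eq_zero_of_injective (n := i) x

/-! ### Exactness of direct limits -/

section DirectLimit

variable {ι : Type*} [Preorder ι] [IsDirectedOrder ι] [Nonempty ι] [DecidableEq ι]
  {A B C : ι → Type*}
  [∀ i, AddCommGroup (A i)] [∀ i, Module R (A i)] [∀ i, AddCommGroup (B i)] [∀ i, Module R (B i)]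
  [∀ i, AddCommGroup (C i)] [∀ i, Module R (C i)]
  {a : ∀ i j, i ≤ j → A i →ₗ[R] A j} {b : ∀ i j, i ≤ j → B i →ₗ[R] B j}
  {c : ∀ i j, i ≤ j → C i →ₗ[R] C j}
  [DirectedSystem B (b · · ·)] [DirectedSystem C (c · · ·)]
  {f : ∀ i, A i →ₗ[R] B i} {g : ∀ i, B i →ₗ[R] C i}

omit [DirectedSystem B (b · · ·)] in
theorem directLimit_map_exact (hf : ∀ i j h, f j ∘ₗ a i j h = b i j h ∘ₗ f i)
    (hg : ∀ i j h, g j ∘ₗ b i j h = c i j h ∘ₗ g i) (H : ∀ i, Function.Exact (f i) (g i)) :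
    Function.Exact (Module.DirectLimit.map f hf) (Module.DirectLimit.map g hg) := by
  intro x
  constructor
  · intro hx
    obtain ⟨i, x, rfl⟩ := Module.DirectLimit.exists_of x
    rw [Module.DirectLimit.map_apply_of] at hx
    obtain ⟨j, hij, hj⟩ := Module.DirectLimit.of.zero_exact hx
    have h : g j (b i j hij x) = 0 := (LinearMap.congr_fun (hg i j hij) x).trans hj
    obtain ⟨y, hy⟩ := (H j _).1 h
    exact ⟨Module.DirectLimit.of R ι A a j y, by
      rw [Module.DirectLimit.map_apply_of, hy, Module.DirectLimit.of_f]⟩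
  · rintro ⟨y, rfl⟩
    obtain ⟨i, y, rfl⟩ := Module.DirectLimit.exists_of y
    rw [Module.DirectLimit.map_apply_of, Module.DirectLimit.map_apply_of,
      (H i).apply_apply_eq_zero, map_zero]

omit [DirectedSystem C (c · · ·)] in
theorem directLimit_map_injective (hf : ∀ i j h, f j ∘ₗ a i j h = b i j h ∘ₗ f i)
    (H : ∀ i, Function.Injective (f i)) : Function.Injective (Module.DirectLimit.map f hf) := by
  refine (injective_iff_map_eq_zero _).2 fun x hx => ?_
  obtain ⟨i, x, rfl⟩ := Module.DirectLimit.exists_of x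
  rw [Module.DirectLimit.map_apply_of] at hx
  obtain ⟨j, hij, hj⟩ := Module.DirectLimit.of.zero_exact hx
  have h : f j (a i j hij x) = 0 := (LinearMap.congr_fun (hf i j hij) x).trans hj
  rw [← Module.DirectLimit.of_f (hij := hij), (injective_iff_map_eq_zero (f j)).1 (H j) _ h,
    map_zero]

end DirectLimit

section

variable (I : Ideal R) (M : Type u) [AddCommGroup M] [Module R M]

/-- This is associativity of the Yoneda product. The degree n of β is arbitrary so that functorial
maps (n = 0) and connecting maps (n = 1) are treated together. -/
theorem postcomp_comp_transition {X Y : ModuleCat.{u} R} {i j n : ℕ}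
    (β : Abelian.Ext.{u} X Y n) (h : i + n = j) (p q : ℕ) (hpq : p ≤ q) :
    β.postcompOfLinear R (ModuleCat.of R (M ⧸ (I ^ q • ⊤ : Submodule R M))) h ∘ₗ
      transition I M X i p q hpq =
    transition I M Y j p q hpq ∘ₗ
      β.postcompOfLinear R (ModuleCat.of R (M ⧸ (I ^ p • ⊤ : Submodule R M))) h := by
  ext x
  exact Abelian.Ext.comp_assoc (Abelian.Ext.mk₀ (ModuleCat.ofHom (Submodule.factorPow I M hpq))) x β
    (zero_add i) h (by omega)

/-- The map `H^i_I(M, X) → H^j_I(M, Y)` given by a class in `Ext^n(X, Y)`, where `i + n = j`. -/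
def genMap {X Y : ModuleCat.{u} R} {i j n : ℕ} (β : Abelian.Ext.{u} X Y n) (h : i + n = j) :
    genLocalCohomology I M X i →ₗ[R] genLocalCohomology I M Y j :=
  Module.DirectLimit.map (fun q => β.postcompOfLinear R
    (ModuleCat.of R (M ⧸ (I ^ q • ⊤ : Submodule R M))) h) (postcomp_comp_transition I M β h)

/-- The map `Ext^i(M / I^q M, N) → H^i_I(M, N)`. -/
def genOf (N : Type u) [AddCommGroup N] [Module R N] (i q : ℕ) :
    ExtModule R (M ⧸ (I ^ q • ⊤ : Submodule R M)) N i →ₗ[R] genLocalCohomology I M N i :=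
  Module.DirectLimit.of R ℕ (fun q : ℕ => ExtModule R (M ⧸ (I ^ q • ⊤ : Submodule R M)) N i)
    (transition I M N i) q

theorem exists_genOf {N : Type u} [AddCommGroup N] [Module R N] {i : ℕ}
    (x : genLocalCohomology I M N i) : ∃ q y, genOf I M N i q y = x :=
  Module.DirectLimit.exists_of x

theorem genMap_genOf {X Y : ModuleCat.{u} R} {i j n : ℕ} (β : Abelian.Ext.{u} X Y n)
    (h : i + n = j) (q : ℕ) (x : ExtModule R (M ⧸ (I ^ q • ⊤ : Submodule R M)) X i) :
    genMap I M β h (genOf I M X i q x) = genOf I M Y j q (Abelian.Ext.comp x β h) :=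
  Module.DirectLimit.map_apply_of (f := transition I M X i) (f' := transition I M Y j)
    (fun q => β.postcompOfLinear R (ModuleCat.of R (M ⧸ (I ^ q • ⊤ : Submodule R M))) h)
    (postcomp_comp_transition I M β h) x

theorem genMap_id (X : ModuleCat.{u} R) (i : ℕ) (x : genLocalCohomology I M X i) :
    genMap I M (Abelian.Ext.mk₀ (𝟙 X)) (add_zero i) x = x := by
  obtain ⟨q, x, rfl⟩ := exists_genOf I M x
  rw [genMap_genOf, Abelian.Ext.comp_mk₀_id]

theorem genMap_comp {X Y Z : ModuleCat.{u} R} (f : X ⟶ Y) (g : Y ⟶ Z) (i : ℕ)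
    (x : genLocalCohomology I M X i) :
    genMap I M (Abelian.Ext.mk₀ (f ≫ g)) (add_zero i) x =
      genMap I M (Abelian.Ext.mk₀ g) (add_zero i)
        (genMap I M (Abelian.Ext.mk₀ f) (add_zero i) x) := by
  obtain ⟨q, x, rfl⟩ := exists_genOf I M x
  rw [genMap_genOf, genMap_genOf, genMap_genOf, Abelian.Ext.comp_assoc_of_third_deg_zero,
    Abelian.Ext.mk₀_comp_mk₀]

/-- The functors `H^i_I(M, -)`. -/
def genFunctor (i : ℕ) : ModuleCat.{u} R ⥤ ModuleCat.{u} R where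
  obj N := ModuleCat.of R (genLocalCohomology I M N i)
  map f := ModuleCat.ofHom (genMap I M (Abelian.Ext.mk₀ f) (add_zero i))
  map_id N := ModuleCat.hom_ext (LinearMap.ext fun x => genMap_id I M N i x)
  map_comp f g := ModuleCat.hom_ext (LinearMap.ext fun x => genMap_comp I M f g i x)

theorem genMap_exact {X Y Z : ModuleCat.{u} R} {i j k m n : ℕ} (β : Abelian.Ext.{u} X Y m)
    (γ : Abelian.Ext.{u} Y Z n) (h : i + m = j) (h' : j + n = k)
    (H : ∀ q : ℕ, Function.Exact
      (β.postcompOfLinear R (ModuleCat.of R (M ⧸ (I ^ q • ⊤ : Submodule R M))) h)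
      (γ.postcompOfLinear R (ModuleCat.of R (M ⧸ (I ^ q • ⊤ : Submodule R M))) h')) :
    Function.Exact (genMap I M β h) (genMap I M γ h') :=
  directLimit_map_exact (a := transition I M X i) (b := transition I M Y j)
    (c := transition I M Z k) (postcomp_comp_transition I M β h)
    (postcomp_comp_transition I M γ h') H

theorem genMap_injective {X Y : ModuleCat.{u} R} {i j m : ℕ} (β : Abelian.Ext.{u} X Y m)
    (h : i + m = j) (H : ∀ q : ℕ, Function.Injective
      (β.postcompOfLinear R (ModuleCat.of R (M ⧸ (I ^ q • ⊤ : Submodule R M))) h)) :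
    Function.Injective (genMap I M β h) :=
  directLimit_map_injective (a := transition I M X i) (b := transition I M Y j)
    (postcomp_comp_transition I M β h) H

theorem isCohomological_genFunctor : IsCohomological (genFunctor I M) where
  injective {S} hS := genMap_injective I M (Abelian.Ext.mk₀ S.f) (add_zero 0)
    fun q => (isCohomological_extFunctor (M ⧸ (I ^ q • ⊤ : Submodule R M))).injective hS
  exact_middle {S} hS i := genMap_exact I M (Abelian.Ext.mk₀ S.f) (Abelian.Ext.mk₀ S.g)
    (add_zero i) (add_zero i)
    fun q => (isCohomological_extFunctor (M ⧸ (I ^ q • ⊤ : Submodule R M))).exact_middle hS i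
  exists_connecting {S} hS i :=
    ⟨genMap I M hS.extClass rfl,
      genMap_exact I M (Abelian.Ext.mk₀ S.g) hS.extClass (add_zero i) rfl fun q =>
        (exact_postcomp_extClass (M ⧸ (I ^ q • ⊤ : Submodule R M)) hS i).1,
      genMap_exact I M hS.extClass (Abelian.Ext.mk₀ S.f) rfl (add_zero (i + 1)) fun q =>
        (exact_postcomp_extClass (M ⧸ (I ^ q • ⊤ : Submodule R M)) hS i).2⟩

theorem subsingleton_genLocalCohomology (N : Type u) [AddCommGroup N] [Module R N] (i : ℕ)
    (h : ∀ q, Subsingleton (ExtModule R (M ⧸ (I ^ q • ⊤ : Submodule R M)) N i)) :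
    Subsingleton (genLocalCohomology I M N i) :=
  subsingleton_of_forall_eq 0 fun x => by
    obtain ⟨q, x, rfl⟩ := exists_genOf I M x
    rw [Subsingleton.elim x 0, map_zero]

theorem vanishesOnInjectives_genFunctor : VanishesOnInjectives (genFunctor I M) :=
  fun E hE i => subsingleton_genLocalCohomology I M E (i + 1) fun _ =>
    vanishesOnInjectives_extFunctor _ E hE i

end

end

/-! ### Degree zero identifications, and Γ_I of injective modules -/

section

variable {R : Type u} [CommRing R]

/-- `Ext^0_R(M, N)` is `Hom_R(M, N)`. -/
def extZeroEquiv (M N : Type u) [AddCommGroup M] [Module R M] [AddCommGroup N] [Module R N] :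
    ExtModule R M N 0 ≃ₗ[R] (M →ₗ[R] N) :=
  Abelian.Ext.linearEquiv₀.trans ModuleCat.homLinearEquiv

theorem extZeroEquiv_mk₀ {M N : Type u} [AddCommGroup M] [Module R M] [AddCommGroup N]
    [Module R N] (φ : ModuleCat.of R M ⟶ ModuleCat.of R N) :
    extZeroEquiv M N (Abelian.Ext.mk₀ φ) = φ.hom := by
  have h : Abelian.Ext.linearEquiv₀ (R := R) (Abelian.Ext.mk₀ φ) = φ :=
    Abelian.Ext.linearEquiv₀.apply_symm_apply φ
  rw [extZeroEquiv, LinearEquiv.trans_apply, h]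
  rfl

/-- `Ext^0_R(M, -)` is `Hom_R(M, -)`. -/
def extFunctorZeroIso (M : Type u) [AddCommGroup M] [Module R M] :
    extFunctor (R := R) M 0 ≅ homFunctor M :=
  NatIso.ofComponents (fun N => (extZeroEquiv M N).toModuleIso) (fun {X Y} f => by
    refine ModuleCat.hom_ext (LinearMap.ext fun x => ?_)
    obtain ⟨φ, rfl⟩ := (Abelian.Ext.mk₀_bijective (ModuleCat.of R M) X).2 x
    change extZeroEquiv M Y ((Abelian.Ext.mk₀ φ).comp (Abelian.Ext.mk₀ f) (add_zero 0)) =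
      f.hom ∘ₗ extZeroEquiv M X (Abelian.Ext.mk₀ φ)
    rw [Abelian.Ext.mk₀_comp_mk₀]
    exact (extZeroEquiv_mk₀ (φ ≫ f)).trans (congrArg (f.hom ∘ₗ ·) (extZeroEquiv_mk₀ φ).symm))

section

variable (I : Ideal R) (M : Type u) [AddCommGroup M] [Module R M]

/-- `Hom_R(M / I^q M, N) → Hom_R(M, Γ_I(N))`. -/
def homToGamma (N : Type u) [AddCommGroup N] [Module R N] (q : ℕ) :
    ((M ⧸ (I ^ q • ⊤ : Submodule R M)) →ₗ[R] N) →ₗ[R] (M →ₗ[R] gamma I N) where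
  toFun φ := LinearMap.codRestrict _ (φ ∘ₗ Submodule.mkQ _) fun m => ⟨q, fun r hr => by
    rw [← map_smul, LinearMap.comp_apply, Submodule.mkQ_apply,
      (Submodule.Quotient.mk_eq_zero _).2 (Submodule.smul_mem_smul hr Submodule.mem_top),
      map_zero]⟩
  map_add' _ _ := rfl
  map_smul' _ _ := rfl

theorem homToGamma_injective (N : Type u) [AddCommGroup N] [Module R N] (q : ℕ) :
    Function.Injective (homToGamma I M N q) := fun φ ψ h => by
  refine Submodule.linearMap_qext _ (LinearMap.ext fun m => ?_)
  exact congrArg Subtype.val (LinearMap.congr_fun h m)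

theorem transition_apply (N : Type u) [AddCommGroup N] [Module R N] (i p q : ℕ) (hpq : p ≤ q)
    (x : ExtModule R (M ⧸ (I ^ p • ⊤ : Submodule R M)) N i) :
    transition I M N i p q hpq x =
      (Abelian.Ext.mk₀ (ModuleCat.ofHom (Submodule.factorPow I M hpq))).comp x (zero_add i) := rfl

theorem homToGamma_factorPow (N : Type u) [AddCommGroup N] [Module R N] (p q : ℕ) (hpq : p ≤ q)
    (φ : (M ⧸ (I ^ p • ⊤ : Submodule R M)) →ₗ[R] N) :
    homToGamma I M N q (φ ∘ₗ Submodule.factorPow I M hpq) = homToGamma I M N p φ := by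
  ext m
  have h : Submodule.factorPow I M hpq (Submodule.mkQ _ m) = Submodule.mkQ _ m :=
    Submodule.factor_mk _ m
  exact congrArg φ h

theorem homToGamma_transition (N : Type u) [AddCommGroup N] [Module R N] (p q : ℕ) (hpq : p ≤ q)
    (x : ExtModule R (M ⧸ (I ^ p • ⊤ : Submodule R M)) N 0) :
    homToGamma I M N q (extZeroEquiv _ N (transition I M N 0 p q hpq x)) =
      homToGamma I M N p (extZeroEquiv _ N x) := by
  obtain ⟨φ, rfl⟩ := (Abelian.Ext.mk₀_bijective _ _).2 x
  rw [transition_apply, Abelian.Ext.mk₀_comp_mk₀, extZeroEquiv_mk₀, extZeroEquiv_mk₀]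
  exact homToGamma_factorPow I M N p q hpq φ.hom

/-- The degree zero part `H^0_I(M, N) → Hom_R(M, Γ_I(N))`. -/
def genToHomGamma (N : Type u) [AddCommGroup N] [Module R N] :
    genLocalCohomology I M N 0 →ₗ[R] (M →ₗ[R] gamma I N) :=
  Module.DirectLimit.lift R ℕ _ (transition I M N 0)
    (fun q => homToGamma I M N q ∘ₗ (extZeroEquiv _ N).toLinearMap)
    (homToGamma_transition I M N)

theorem genToHomGamma_genOf (N : Type u) [AddCommGroup N] [Module R N] (q : ℕ)
    (φ : ModuleCat.of R (M ⧸ (I ^ q • ⊤ : Submodule R M)) ⟶ ModuleCat.of R N) :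
    genToHomGamma I M N (genOf I M N 0 q (Abelian.Ext.mk₀ φ)) = homToGamma I M N q φ.hom :=
  (Module.DirectLimit.lift_of (f := transition I M N 0) _ _ _).trans
    (congrArg (homToGamma I M N q) (extZeroEquiv_mk₀ φ))

theorem genToHomGamma_injective (N : Type u) [AddCommGroup N] [Module R N] :
    Function.Injective (genToHomGamma I M N) :=
  Module.DirectLimit.lift_injective _ _ fun q =>
    (homToGamma_injective I M N q).comp (LinearEquiv.injective _)

/-- A map from a finitely generated M to Γ_I(N) is killed by a single power I^q, hence factors
through M/I^qM. -/
theorem genToHomGamma_surjective [Module.Finite R M] (N : Type u) [AddCommGroup N] [Module R N] :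
    Function.Surjective (genToHomGamma I M N) := fun ψ => by
  obtain ⟨q, hq⟩ := exists_pow_smul_eq_zero I ((gamma I N).subtype ∘ₗ ψ) fun x => (ψ x).2
  have h : (I ^ q • ⊤ : Submodule R M) ≤ LinearMap.ker ((gamma I N).subtype ∘ₗ ψ) :=
    Submodule.smul_le.2 fun r hr x _ => by rw [LinearMap.mem_ker, map_smul, hq r hr]
  refine ⟨genOf I M N 0 q (Abelian.Ext.mk₀ (ModuleCat.ofHom (Submodule.liftQ _ _ h))), ?_⟩
  rw [genToHomGamma_genOf]
  ext m
  rfl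

/-- For `M` finitely generated, `H^0_I(M, -)` is `Hom_R(M, Γ_I(-))`. -/
def genFunctorZeroIso [Module.Finite R M] :
    genFunctor I M 0 ≅ gammaFunctor I ⋙ homFunctor M :=
  NatIso.ofComponents
    (fun N => (LinearEquiv.ofBijective (genToHomGamma I M N)
      ⟨genToHomGamma_injective I M N, genToHomGamma_surjective I M N⟩).toModuleIso)
    (fun {X Y} f => by
      refine ModuleCat.hom_ext (LinearMap.ext fun x => ?_)
      obtain ⟨q, x, rfl⟩ := exists_genOf I M x
      obtain ⟨φ, rfl⟩ := (Abelian.Ext.mk₀_bijective _ _).2 x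
      change genToHomGamma I M Y (genMap I M (Abelian.Ext.mk₀ f) (add_zero 0)
        (genOf I M X 0 q (Abelian.Ext.mk₀ φ))) =
        ((gammaFunctor I).map f).hom ∘ₗ genToHomGamma I M X (genOf I M X 0 q (Abelian.Ext.mk₀ φ))
      rw [genMap_genOf, Abelian.Ext.mk₀_comp_mk₀]
      refine (genToHomGamma_genOf I M Y q (φ ≫ f)).trans ?_
      rw [genToHomGamma_genOf]
      rfl)

/-- `Hom_R(R, -)` is the identity. -/
def homFunctorSelfIso : homFunctor (R := R) R ≅ 𝟭 _ :=
  NatIso.ofComponents (fun N => (LinearMap.ringLmapEquivSelf R R N).toModuleIso) (fun _ => rfl)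

/-- `H^0_I` is `Γ_I`. -/
def locFunctorZeroIso : genFunctor I R 0 ≅ gammaFunctor I :=
  genFunctorZeroIso I R ≪≫ Functor.isoWhiskerLeft (gammaFunctor I) homFunctorSelfIso ≪≫
    Functor.rightUnitor _

/-- For `M` finitely generated, `Hom_R(M, Γ_I(X))` is `Γ_I(Hom_R(M, X))`. -/
def homGammaEquiv [Module.Finite R M] (X : Type u) [AddCommGroup X] [Module R X] :
    (M →ₗ[R] gamma I X) ≃ₗ[R] gamma I (M →ₗ[R] X) where
  toFun φ := ⟨(gamma I X).subtype ∘ₗ φ, by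
    obtain ⟨q, hq⟩ := exists_pow_smul_eq_zero I ((gamma I X).subtype ∘ₗ φ) fun x => (φ x).2
    exact ⟨q, fun r hr => LinearMap.ext (hq r hr)⟩⟩
  invFun φ := LinearMap.codRestrict _ φ.1 fun m => by
    obtain ⟨q, hq⟩ := φ.2
    exact ⟨q, fun r hr => LinearMap.congr_fun (hq r hr) m⟩
  map_add' _ _ := rfl
  map_smul' _ _ := rfl
  left_inv _ := rfl
  right_inv _ := rfl

/-- For `M` finitely generated, `Hom_R(M, -)` commutes with `Γ_I`. -/
def homGammaIso [Module.Finite R M] :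
    homFunctor M ⋙ gammaFunctor I ≅ gammaFunctor I ⋙ homFunctor M :=
  NatIso.ofComponents (fun N => (homGammaEquiv I M N).symm.toModuleIso) (fun _ => rfl)

end

theorem mem_gamma_sup (I J : Ideal R) (X : Type u) [AddCommGroup X] [Module R X] {x : X} :
    x ∈ gamma (I ⊔ J) X ↔ x ∈ gamma I X ∧ x ∈ gamma J X := by
  constructor
  · rintro ⟨q, hq⟩
    exact ⟨⟨q, fun r hr => hq r (Ideal.pow_right_mono le_sup_left q hr)⟩,
      ⟨q, fun r hr => hq r (Ideal.pow_right_mono le_sup_right q hr)⟩⟩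
  · rintro ⟨⟨p, hp⟩, ⟨q, hq⟩⟩
    refine ⟨p + q, fun r hr => ?_⟩
    -- The reverse inclusion rests on (I + J)^{p+q} ⊆ I^p + J^q.
    have h : I ^ p ⊔ J ^ q ≤ LinearMap.ker (LinearMap.toSpanSingleton R X x) := sup_le hp hq
    exact h (Ideal.sup_pow_add_le_pow_sup_pow hr)

/-- `Γ_J(Γ_I(X))` is `Γ_{I + J}(X)`. -/
def gammaSupEquiv (I J : Ideal R) (X : Type u) [AddCommGroup X] [Module R X] :
    gamma J (gamma I X) ≃ₗ[R] gamma (I ⊔ J) X where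
  toFun x := ⟨x.1.1, (mem_gamma_sup I J X).2 ⟨x.1.2, map_mem_gamma J (gamma I X).subtype x.2⟩⟩
  invFun x := ⟨⟨x.1, ((mem_gamma_sup I J X).1 x.2).1⟩, by
    obtain ⟨q, hq⟩ := ((mem_gamma_sup I J X).1 x.2).2
    exact ⟨q, fun r hr => Subtype.ext (hq r hr)⟩⟩
  map_add' _ _ := rfl
  map_smul' _ _ := rfl
  left_inv _ := rfl
  right_inv _ := rfl

/-- `Γ_J ∘ Γ_I` is `Γ_{I + J}`. -/
def gammaSupIso (I J : Ideal R) : gammaFunctor I ⋙ gammaFunctor J ≅ gammaFunctor (I ⊔ J) :=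
  NatIso.ofComponents (fun N => (gammaSupEquiv I J N).toModuleIso) (fun _ => rfl)

/-- By Baer's criterion it suffices to extend f : J → Γ_I(E). Since J is finitely generated, some
I^q kills f, and Artin–Rees gives J ∩ I^{q+k} ⊆ I^q J ⊆ ker f. So f factors through the image of J
in R/I^{q+k}; extending from there to R/I^{q+k} keeps the values I-torsion. -/
theorem injective_gamma [IsNoetherianRing R] (I : Ideal R) (E : Type u) [AddCommGroup E]
    [Module R E] (hE : Module.Injective R E) : Module.Injective R (gamma I E) := by
  refine Module.Baer.injective fun J f => ?_
  obtain ⟨q, hq⟩ := exists_pow_smul_eq_zero I ((gamma I E).subtype ∘ₗ f) fun x => (f x).2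
  obtain ⟨k, hk⟩ := Ideal.exists_pow_inf_eq_pow_smul I (J : Submodule R R)
  have hk' := hk (q + k) (Nat.le_add_left k q)
  have hker : ∀ (x : R) (hx : x ∈ J), x ∈ I ^ (q + k) → f ⟨x, hx⟩ = 0 := by
    intro x hx hxI
    have h₁ : x ∈ (I ^ q • J : Submodule R R) := by
      have h₂ : x ∈ (I ^ (q + k) • ⊤ ⊓ J : Submodule R R) :=
        ⟨by simpa using hxI, hx⟩
      rw [hk', Nat.add_sub_cancel] at h₂
      exact Submodule.smul_mono le_rfl inf_le_right h₂
    have h₃ : (I ^ q • J : Submodule R R) ≤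
        (LinearMap.ker ((gamma I E).subtype ∘ₗ f)).map (Submodule.subtype J) :=
      Submodule.smul_le.2 fun r hr y hy =>
        ⟨r • ⟨y, hy⟩, by rw [SetLike.mem_coe, LinearMap.mem_ker, map_smul, hq r hr], rfl⟩
    obtain ⟨y, hy, rfl⟩ := h₃ h₁
    exact Subtype.ext hy
  let φ : J →ₗ[R] (R ⧸ I ^ (q + k)) := (Submodule.mkQ (I ^ (q + k))) ∘ₗ Submodule.subtype J
  have hφ : LinearMap.ker φ ≤ LinearMap.ker ((gamma I E).subtype ∘ₗ f) := fun x hx => by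
    have hx' : x.1 ∈ I ^ (q + k) := (Submodule.Quotient.mk_eq_zero _).1 hx
    rw [LinearMap.mem_ker, LinearMap.comp_apply, hker x.1 x.2 hx', map_zero]
  let ψ : (J ⧸ LinearMap.ker φ) →ₗ[R] E := Submodule.liftQ _ ((gamma I E).subtype ∘ₗ f) hφ
  have hinj : Function.Injective ((LinearMap.ker φ).liftQ φ le_rfl) :=
    LinearMap.ker_eq_bot.1 (Submodule.ker_liftQ_eq_bot _ _ _ le_rfl)
  obtain ⟨h, hh⟩ := hE.out _ hinj ψ
  refine ⟨LinearMap.codRestrict _ (h ∘ₗ Submodule.mkQ (I ^ (q + k))) fun x => ⟨q + k, fun r hr => ?_⟩,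
    fun x hx => Subtype.ext (hh (Submodule.Quotient.mk ⟨x, hx⟩))⟩
  have hrx : r • x ∈ I ^ (q + k) := Ideal.mul_mem_right x _ hr
  rw [← map_smul, LinearMap.comp_apply, Submodule.mkQ_apply,
    (Submodule.Quotient.mk_eq_zero _).2 hrx, map_zero]

end

/-! ### Vanishing forms of the three spectral sequences -/

section

variable {R : Type u} [CommRing R] [IsNoetherianRing R]

theorem injective_genFunctor_zero (I : Ideal R) (E : ModuleCat.{u} R) (hE : Injective E) :
    Injective ((genFunctor I R 0).obj E) := by
  have : Injective (ModuleCat.of R E) := hE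
  have h := injective_gamma I E (Module.injective_module_of_injective_object R E)
  have : Injective ((gammaFunctor I).obj E) :=
    Module.injective_object_of_injective_module R (gamma I E)
  exact Injective.of_iso ((locFunctorZeroIso I).app E).symm this

/-- A vanishing form of the spectral sequence `Ext^p(M, H^q_I(N)) ⇒ H^{p+q}_I(M, N)`. -/
theorem subsingleton_of_ext_locCohomology (I : Ideal R) (M N : Type u) [AddCommGroup M]
    [Module R M] [Module.Finite R M] [AddCommGroup N] [Module R N] (n : ℕ)
    (h : ∀ p q, p + q = n → Subsingleton (ExtModule R M (locCohomology I N q) p)) :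
    Subsingleton (genLocalCohomology I M N n) :=
  subsingleton_of_composite (T := extFunctor M) (G := genFunctor I R) (K := genFunctor I M)
    (isCohomological_extFunctor M) (isCohomological_genFunctor I R)
    (isCohomological_genFunctor I M) (vanishesOnInjectives_genFunctor I R)
    (vanishesOnInjectives_genFunctor I M)
    (fun E hE => vanishesOnInjectives_extFunctor M _ (injective_genFunctor_zero I E hE))
    (Functor.isoWhiskerRight (locFunctorZeroIso I) _ ≪≫
      Functor.isoWhiskerLeft _ (extFunctorZeroIso M) ≪≫ (genFunctorZeroIso I M).symm)
    n (ModuleCat.of R N) h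

/-- A vanishing form of the spectral sequence `H^p_J(H^q_I(N)) ⇒ H^{p+q}_{I + J}(N)`. -/
theorem subsingleton_of_locCohomology_locCohomology (I J : Ideal R) (N : Type u)
    [AddCommGroup N] [Module R N] (n : ℕ)
    (h : ∀ p q, p + q = n → Subsingleton (locCohomology J (locCohomology I N q) p)) :
    Subsingleton (locCohomology (I ⊔ J) N n) :=
  subsingleton_of_composite (T := genFunctor J R) (G := genFunctor I R) (K := genFunctor (I ⊔ J) R)
    (isCohomological_genFunctor J R) (isCohomological_genFunctor I R)
    (isCohomological_genFunctor (I ⊔ J) R) (vanishesOnInjectives_genFunctor I R)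
    (vanishesOnInjectives_genFunctor (I ⊔ J) R)
    (fun E hE => vanishesOnInjectives_genFunctor J R _ (injective_genFunctor_zero I E hE))
    (Functor.isoWhiskerRight (locFunctorZeroIso I) _ ≪≫
      Functor.isoWhiskerLeft _ (locFunctorZeroIso J) ≪≫ gammaSupIso I J ≪≫
        (locFunctorZeroIso (I ⊔ J)).symm)
    n (ModuleCat.of R N) h

omit [IsNoetherianRing R] in
theorem surjective_genFunctor_zero_map (I : Ideal R) {X Y : ModuleCat.{u} R} (f : X ⟶ Y)
    (h : Function.Surjective ((gammaFunctor I).map f).hom) :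
    Function.Surjective ((genFunctor I R 0).map f).hom := by
  have hn := (locFunctorZeroIso I).hom.naturality f
  have hn' : (genFunctor I R 0).map f = ((locFunctorZeroIso I).app X).hom ≫
      (gammaFunctor I).map f ≫ ((locFunctorZeroIso I).app Y).inv := by
    rw [← Category.assoc, Iso.eq_comp_inv]
    exact hn
  rw [hn']
  exact (((locFunctorZeroIso I).app Y).symm.toLinearEquiv.surjective.comp h).comp
    ((locFunctorZeroIso I).app X).toLinearEquiv.surjective

/-- Hom(M,E) need not be injective, but it is Γ_I-acyclic. For 0 → K → R^n → M → 0, the sequence 0 →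
Hom(M,E) → Hom(R^n,E) → Hom(K,E) → 0 is exact with injective middle term, which shifts degrees from
M to K. -/
theorem subsingleton_locCohomology_hom_of_injective (I : Ideal R) (E : Type u) [AddCommGroup E]
    [Module R E] (hE : Module.Injective R E) (p : ℕ) (M : Type u) [AddCommGroup M] [Module R M]
    [Module.Finite R M] : Subsingleton (locCohomology I (M →ₗ[R] E) (p + 1)) := by
  obtain ⟨n, π, hπ⟩ := Module.Finite.exists_fin' R M
  let K := LinearMap.ker π
  have hS := shortExact_of_linearMap (π.lcomp R E) ((Submodule.subtype K).lcomp R E)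
    (LinearMap.lcomp_injective_of_surjective π hπ)
    (fun φ => by
      obtain ⟨ψ, hψ⟩ := hE.out _ K.injective_subtype φ
      exact ⟨ψ, LinearMap.ext hψ⟩)
    (LinearMap.exact_lcomp_of_exact_of_surjective E (LinearMap.exact_subtype_ker_map π) hπ)
  have hF : Module.Injective R ((Fin n → R) →ₗ[R] E) := by
    have e : (Fin n → E) ≃ₗ[R] ((Fin n → R) →ₗ[R] E) := (Pi.basisFun R (Fin n)).constr R
    have h : Module.Injective R (Fin n → E) := inferInstance
    exact Module.Baer.injective ((Module.Baer.of_injective h).of_equiv e)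
  have : ∀ i, Subsingleton ((genFunctor I R (i + 1)).obj (ModuleCat.of R ((Fin n → R) →ₗ[R] E))) :=
    vanishesOnInjectives_genFunctor I R _
      (Module.injective_object_of_injective_module R ((Fin n → R) →ₗ[R] E))
  cases p with
  | zero =>
    refine (isCohomological_genFunctor I R).subsingleton_X₁_of_surjective hS 0
      (surjective_genFunctor_zero_map I _ fun φ => ?_)
    -- Γ_I Hom(-,E) = Hom(-,Γ_I E) on finitely generated modules, and Γ_I E is injective, so maps
    -- extend from K to R^n.
    obtain ⟨ψ, hψ⟩ := (injective_gamma I E hE).out _ K.injective_subtype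
      ((homGammaEquiv I K E).symm φ)
    exact ⟨homGammaEquiv I (Fin n → R) E ψ, Subtype.ext (LinearMap.ext fun x =>
      congrArg Subtype.val (hψ x))⟩
  | succ p =>
    have : Subsingleton ((genFunctor I R (p + 1)).obj (ModuleCat.of R (K →ₗ[R] E))) :=
      subsingleton_locCohomology_hom_of_injective I E hE p K
    exact (isCohomological_genFunctor I R).subsingleton_X₁ hS (p + 1)

/-- A vanishing form of the spectral sequence `H^p_I(Ext^q(M, N)) ⇒ H^{p+q}_I(M, N)`. -/
theorem subsingleton_of_locCohomology_ext (I : Ideal R) (M N : Type u) [AddCommGroup M]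
    [Module R M] [Module.Finite R M] [AddCommGroup N] [Module R N] (n : ℕ)
    (h : ∀ p q, p + q = n → Subsingleton (locCohomology I (ExtModule R M N q) p)) :
    Subsingleton (genLocalCohomology I M N n) :=
  subsingleton_of_composite (T := genFunctor I R) (G := extFunctor M) (K := genFunctor I M)
    (isCohomological_genFunctor I R) (isCohomological_extFunctor M)
    (isCohomological_genFunctor I M) (vanishesOnInjectives_extFunctor M)
    (vanishesOnInjectives_genFunctor I M)
    (fun E hE p => by
      have : Injective (ModuleCat.of R E) := hE
      have : Subsingleton ((genFunctor I R (p + 1)).obj ((homFunctor M).obj E)) :=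
        subsingleton_locCohomology_hom_of_injective I E
          (Module.injective_module_of_injective_object R E) p M
      exact subsingleton_obj_of_linearEquiv _ ((extFunctorZeroIso M).app E).toLinearEquiv)
    (Functor.isoWhiskerRight (extFunctorZeroIso M) _ ≪≫
      Functor.isoWhiskerLeft _ (locFunctorZeroIso I) ≪≫ homGammaIso I M ≪≫
        (genFunctorZeroIso I M).symm)
    n (ModuleCat.of R N) h

end

/-! ### Finiteness of the cohomological dimension -/

section

variable {R : Type u} [CommRing R]

theorem subsingleton_extModule_of_subsingleton (M N : Type u) [AddCommGroup M] [Module R M]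
    [AddCommGroup N] [Module R N] [Subsingleton N] (i : ℕ) : Subsingleton (ExtModule R M N i) :=
  subsingleton_of_forall_eq 0 fun x => by
    have h : 𝟙 (ModuleCat.of R N) = 0 := ModuleCat.hom_ext (LinearMap.ext fun y =>
      Subsingleton.elim (α := N) _ _)
    rw [← Abelian.Ext.comp_mk₀_id x, h, Abelian.Ext.mk₀_zero, Abelian.Ext.comp_zero]

theorem subsingleton_genLocalCohomology_of_subsingleton (I : Ideal R) (M N : Type u)
    [AddCommGroup M] [Module R M] [AddCommGroup N] [Module R N] [Subsingleton N] (i : ℕ) :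
    Subsingleton (genLocalCohomology I M N i) :=
  subsingleton_genLocalCohomology I M N i fun _ => subsingleton_extModule_of_subsingleton _ N i

/-- This expresses surjectivity of E → E_x. The annihilators of the powers of x stabilise at some m,
so r x^{m+q} ↦ r x^m e is well defined on the ideal (x^{m+q}); e' is the value at 1 of an extension
to R. -/
theorem exists_pow_add_smul_eq [IsNoetherianRing R] {E : Type u} [AddCommGroup E] [Module R E]
    (hE : Module.Injective R E) (x : R) (e : E) (q : ℕ) :
    ∃ (m : ℕ) (e' : E), x ^ (m + q) • e' = x ^ m • e := by
  let μ : ℕ → R →ₗ[R] R := fun k => LinearMap.toSpanSingleton R R (x ^ k)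
  have hmem : ∀ {k r}, r ∈ LinearMap.ker (μ k) ↔ r * x ^ k = 0 := Iff.rfl
  let a : ℕ →o Submodule R R := ⟨fun k => LinearMap.ker (μ k), monotone_nat_of_le_succ
    fun k r hr => by rw [hmem] at hr ⊢; rw [pow_succ, ← mul_assoc, hr, zero_mul]⟩
  obtain ⟨m, hm⟩ := monotone_stabilizes_iff_noetherian.2 ‹IsNoetherianRing R› a
  have hker : LinearMap.ker (μ (m + q)) ≤
      LinearMap.ker (LinearMap.toSpanSingleton R E (x ^ m • e)) := by
    intro r hr
    have hr' : r ∈ LinearMap.ker (μ m) := (hm (m + q) (Nat.le_add_right m q)).ge hr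
    rw [hmem] at hr'
    rw [LinearMap.mem_ker, LinearMap.toSpanSingleton_apply, smul_smul, hr', zero_smul]
  obtain ⟨h, hh⟩ := hE.out ((LinearMap.ker (μ (m + q))).liftQ (μ (m + q)) le_rfl)
    (LinearMap.ker_eq_bot.1 (Submodule.ker_liftQ_eq_bot _ _ _ le_rfl))
    (Submodule.liftQ _ _ hker)
  refine ⟨m, h 1, ?_⟩
  have h₁ : h (1 * x ^ (m + q)) = (1 : R) • x ^ m • e := hh (Submodule.Quotient.mk 1)
  rw [← map_smul, smul_eq_mul, mul_one]
  rwa [one_mul, one_smul] at h₁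

/-- Quotients of injectives inherit surjectivity of localisation at x, which lets a torsion element
of C₁ be lifted to a torsion element of E₁. Higher degrees shift to C₁, again a quotient of an
injective. -/
theorem subsingleton_locCohomology_span_singleton_of_surjective [IsNoetherianRing R] (x : R)
    {E C : Type u} [AddCommGroup E] [Module R E] [AddCommGroup C] [Module R C]
    (hE : Module.Injective R E) (π : E →ₗ[R] C) (hπ : Function.Surjective π) (p : ℕ) :
    Subsingleton (locCohomology (Ideal.span {x}) C (p + 1)) := by
  obtain ⟨E₁, C₁, f, g, w, hE₁, hS⟩ := exists_injective_shortExact (ModuleCat.of R C)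
  have hF := isCohomological_genFunctor (Ideal.span {x}) R
  have hV := vanishesOnInjectives_genFunctor (Ideal.span {x}) R E₁ hE₁
  cases p with
  | zero =>
    refine hF.subsingleton_X₁_of_surjective hS 0 (surjective_genFunctor_zero_map _ _ ?_)
    rintro ⟨z, q, hz⟩
    obtain ⟨y, rfl⟩ := hS.moduleCat_surjective_g z
    have hy : g.hom (x ^ q • y) = 0 := by
      rw [map_smul]
      exact hz _ (Ideal.pow_mem_pow (Ideal.mem_span_singleton_self x) q)
    obtain ⟨c, hc⟩ := ((ShortComplex.ShortExact.moduleCat_exact_iff_function_exact _).1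
      hS.exact _).1 hy
    obtain ⟨e, rfl⟩ := hπ c
    obtain ⟨m, e', he⟩ := exists_pow_add_smul_eq hE x e q
    have hw : ∀ c, g.hom (f.hom c) = 0 := fun c => LinearMap.congr_fun (congrArg (·.hom) w) c
    have hc' : f.hom (π e) = x ^ q • y := hc
    -- The lift y is corrected by an element coming from C, so its image in C₁ does not change.
    have h₁ : x ^ (m + q) • (y - f.hom (π e')) = 0 := by
      rw [smul_sub, pow_add, mul_smul, ← hc', ← map_smul, ← map_smul, ← map_smul, ← map_smul,
        ← pow_add, he, sub_self]
    refine ⟨⟨y - f.hom (π e'), m + q, fun r hr => ?_⟩, Subtype.ext ?_⟩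
    · rw [Ideal.span_singleton_pow, Ideal.mem_span_singleton'] at hr
      obtain ⟨s, rfl⟩ := hr
      rw [mul_smul, h₁, smul_zero]
    · change g.hom (y - f.hom (π e')) = g.hom y
      rw [map_sub, hw, sub_zero]
  | succ p =>
    have : Injective (ModuleCat.of R E₁) := hE₁
    have : Subsingleton ((genFunctor (Ideal.span {x}) R (p + 1)).obj C₁) :=
      subsingleton_locCohomology_span_singleton_of_surjective x
        (Module.injective_module_of_injective_object R E₁) g.hom hS.moduleCat_surjective_g p
    exact hF.subsingleton_X₁ hS (p + 1)

theorem subsingleton_locCohomology_span_singleton [IsNoetherianRing R] (x : R)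
    (N : Type u) [AddCommGroup N] [Module R N] (p : ℕ) :
    Subsingleton (locCohomology (Ideal.span {x}) N (p + 2)) := by
  obtain ⟨E, C, f, g, w, hE, hS⟩ := exists_injective_shortExact (ModuleCat.of R N)
  have := vanishesOnInjectives_genFunctor (Ideal.span {x}) R E hE
  have : Injective (ModuleCat.of R E) := hE
  have : Subsingleton ((genFunctor (Ideal.span {x}) R (p + 1)).obj C) :=
    subsingleton_locCohomology_span_singleton_of_surjective x
      (Module.injective_module_of_injective_object R E) g.hom hS.moduleCat_surjective_g p
  exact (isCohomological_genFunctor (Ideal.span {x}) R).subsingleton_X₁ hS (p + 1)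

/-- Over a Noetherian ring the cohomological dimension of an ideal is finite. -/
theorem exists_bound_locCohomology [IsNoetherianRing R] (I : Ideal R) :
    ∃ B : ℕ, ∀ (N : Type u) [AddCommGroup N] [Module R N] (i : ℕ), B ≤ i →
      Subsingleton (locCohomology I N i) := by
  refine Submodule.fg_induction (motive := fun (I : Ideal R) _ => ∃ B : ℕ, ∀ (N : Type u) [AddCommGroup N]
    [Module R N] (i : ℕ), B ≤ i → Subsingleton (locCohomology I N i)) (fun x => ⟨2, ?_⟩) ?_ I
    (IsNoetherian.noetherian I)
  · intro N _ _ i hi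
    obtain ⟨p, rfl⟩ := Nat.exists_eq_add_of_le' hi
    exact subsingleton_locCohomology_span_singleton x N p
  · rintro I J - - ⟨A, hA⟩ ⟨B, hB⟩
    -- If p + q ≥ A + B, then p ≥ B or q ≥ A, so every term H^p_J(H^q_I(N)) vanishes.
    refine ⟨A + B, fun N _ _ i hi => subsingleton_of_locCohomology_locCohomology I J N i
      fun p q hpq => ?_⟩
    rcases le_or_gt B p with h | h
    · exact hB _ p h
    · have := hA N q (by omega)
      exact subsingleton_genLocalCohomology_of_subsingleton J R _ p

end

/-! ### Cohomological dimension and support -/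

section

variable {R : Type u} [CommRing R]

/-- The fibre of K at p is a nonzero vector space over the residue field, so it has a nonzero
functional; finite generation of K allows its denominators to be cleared. -/
theorem exists_ne_zero_hom_quotient {K : Type u} [AddCommGroup K] [Module R K] [Module.Finite R K]
    (p : PrimeSpectrum R) (hp : p ∈ Module.support R K) :
    ∃ φ : K →ₗ[R] R ⧸ p.asIdeal, φ ≠ 0 := by
  let k := p.asIdeal.ResidueField
  have : Nontrivial (k ⊗[R] K) :=
    (Module.mem_support_iff_nontrivial_residueField_tensorProduct p).1 hp
  obtain ⟨v, hv⟩ := exists_ne (0 : k ⊗[R] K)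
  obtain ⟨l, hl⟩ : ∃ l : Module.Dual k (k ⊗[R] K), l v ≠ 0 := by
    by_contra! h
    exact hv ((Module.forall_dual_apply_eq_zero_iff k v).1 h)
  let ψ : K →ₗ[R] k := l.restrictScalars R ∘ₗ TensorProduct.mk R k K 1
  have hψ : ψ ≠ 0 := by
    intro h
    apply hl
    have : l = 0 := by
      ext x
      exact LinearMap.congr_fun h x
    rw [this, LinearMap.zero_apply]
  let ι : (R ⧸ p.asIdeal) →ₗ[R] k := (Algebra.linearMap (R ⧸ p.asIdeal) k).restrictScalars R
  have hι : Function.Injective ι := IsFractionRing.injective (R ⧸ p.asIdeal) k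
  classical
  obtain ⟨s, hs⟩ := Module.Finite.fg_top (R := R) (M := K)
  obtain ⟨b, hb⟩ := IsLocalization.exist_integer_multiples_of_finset
    (nonZeroDivisors (R ⧸ p.asIdeal)) (s.image ψ)
  have hmem : ∀ x, b.1 • ψ x ∈ LinearMap.range ι := by
    intro x
    have h : (⊤ : Submodule R K) ≤ (LinearMap.range ι).comap
        ((LinearMap.lsmul (R ⧸ p.asIdeal) k b.1).restrictScalars R ∘ₗ ψ) := by
      rw [← hs, Submodule.span_le]
      intro y hy
      obtain ⟨a, ha⟩ := hb (ψ y) (Finset.mem_image_of_mem _ hy)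
      exact ⟨a, ha⟩
    exact h Submodule.mem_top
  let e := LinearEquiv.ofInjective ι hι
  let χ : K →ₗ[R] k := (LinearMap.lsmul (R ⧸ p.asIdeal) k b.1).restrictScalars R ∘ₗ ψ
  refine ⟨e.symm.toLinearMap ∘ₗ χ.codRestrict (LinearMap.range ι) hmem, fun h => hψ ?_⟩
  ext x
  have h₁ := LinearMap.congr_fun h x
  have h₂ : (χ.codRestrict (LinearMap.range ι) hmem) x = 0 := e.symm.map_eq_zero_iff.1 h₁
  have h₃ : b.1 • ψ x = 0 := congrArg Subtype.val h₂
  rw [Algebra.smul_def, mul_eq_zero] at h₃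
  exact h₃.resolve_left (IsLocalization.to_map_ne_zero_of_mem_nonZeroDivisors k le_rfl b.2)

variable [IsNoetherianRing R]

theorem subsingleton_locCohomology_of_support_primes (I : Ideal R) (i : ℕ) (L : Type u)
    [AddCommGroup L] [Module R L] [Module.Finite R L]
    (h : ∀ p ∈ Module.support R L, Subsingleton (locCohomology I (R ⧸ p.asIdeal) i)) :
    Subsingleton (locCohomology I L i) := by
  revert h
  refine IsNoetherianRing.induction_on_isQuotientEquivQuotientPrime R
    (motive := fun L _ _ _ => (∀ p ∈ Module.support R L,
      Subsingleton (locCohomology I (R ⧸ p.asIdeal) i)) → Subsingleton (locCohomology I L i))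
    ‹Module.Finite R L› ?_ ?_ ?_
  · intro N _ _ _ _ _
    exact subsingleton_genLocalCohomology_of_subsingleton I R N i
  · intro N _ _ _ p e h
    have : Subsingleton ((genFunctor I R i).obj (ModuleCat.of R (R ⧸ p.asIdeal))) :=
      h p (by
        rw [e.support_eq, Module.mem_support_iff_of_finite, Ideal.annihilator_quotient])
    exact subsingleton_obj_of_linearEquiv (A := ModuleCat.of R N)
      (B := ModuleCat.of R (R ⧸ p.asIdeal)) (genFunctor I R i) e
  · intro A _ _ _ B _ _ _ C _ _ _ f g hf hg hfg hA hC h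
    rw [Module.support_of_exact hfg hf hg] at h
    have : Subsingleton ((genFunctor I R i).obj (ModuleCat.of R A)) :=
      hA fun p hp => h p (Or.inl hp)
    have : Subsingleton ((genFunctor I R i).obj (ModuleCat.of R C)) :=
      hC fun p hp => h p (Or.inr hp)
    exact (isCohomological_genFunctor I R).subsingleton_X₂ (shortExact_of_linearMap f g hf hg hfg) i

/-- Vanishing of H^{i+1}_I on the kernel makes H^i_I right exact here. -/
theorem subsingleton_locCohomology_of_surjective (I : Ideal R) (i : ℕ) {L L' : Type u}
    [AddCommGroup L] [Module R L] [Module.Finite R L] [AddCommGroup L'] [Module R L']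
    (h : ∀ (A : Type u) [AddCommGroup A] [Module R A] [Module.Finite R A],
      Module.support R A ⊆ Module.support R L → Subsingleton (locCohomology I A (i + 1)))
    (f : L →ₗ[R] L') (hf : Function.Surjective f) (hL : Subsingleton (locCohomology I L i)) :
    Subsingleton (locCohomology I L' i) := by
  have hS := shortExact_of_linearMap (LinearMap.ker f).subtype f (Submodule.injective_subtype _) hf
    (LinearMap.exact_subtype_ker_map f)
  have : Subsingleton ((genFunctor I R (i + 1)).obj (ModuleCat.of R (LinearMap.ker f))) :=
    h _ (Module.support_subset_of_injective _ (Submodule.injective_subtype _))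
  have : Subsingleton ((genFunctor I R i).obj (ModuleCat.of R L)) := hL
  exact (isCohomological_genFunctor I R).subsingleton_X₃ hS i

/-- A nonzero map K → R/p has image J with H^i_I(J) = 0, as J is a quotient of K. The cokernel
(R/p)/J is supported at primes strictly above p, which Noetherian induction handles, and R/p lies
between the two. -/
theorem subsingleton_locCohomology_quotient_prime (I : Ideal R) (i : ℕ) {K : Type u}
    [AddCommGroup K] [Module R K] [Module.Finite R K]
    (h : ∀ (A : Type u) [AddCommGroup A] [Module R A] [Module.Finite R A],
      Module.support R A ⊆ Module.support R K → Subsingleton (locCohomology I A (i + 1)))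
    (hK : Subsingleton (locCohomology I K i)) (p : PrimeSpectrum R)
    (hp : p ∈ Module.support R K) : Subsingleton (locCohomology I (R ⧸ p.asIdeal) i) := by
  induction p using (InvImage.wf PrimeSpectrum.asIdeal (wellFounded_gt (α := Ideal R))).induction
  rename_i p ih
  obtain ⟨φ, hφ⟩ := exists_ne_zero_hom_quotient p hp
  let J := LinearMap.range φ
  have hS := shortExact_of_linearMap J.subtype J.mkQ J.injective_subtype J.mkQ_surjective
    (LinearMap.exact_subtype_mkQ J)
  have h₁ : Subsingleton ((genFunctor I R i).obj (ModuleCat.of R J)) :=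
    subsingleton_locCohomology_of_surjective I i h φ.rangeRestrict φ.surjective_rangeRestrict hK
  have h₂ : Subsingleton ((genFunctor I R i).obj (ModuleCat.of R ((R ⧸ p.asIdeal) ⧸ J))) := by
    refine subsingleton_locCohomology_of_support_primes I i _ fun q hq => ?_
    have hpq : p ≤ q := by
      have := Module.support_subset_of_surjective J.mkQ J.mkQ_surjective hq
      rwa [Module.mem_support_iff_of_finite, Ideal.annihilator_quotient] at this
    refine ih q (lt_of_le_of_ne hpq ?_) (Module.mem_support_mono hpq hp)
    intro hpq'
    obtain rfl : p = q := PrimeSpectrum.ext hpq'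
    -- A lift r of a nonzero value of φ kills (R/p)/J but is not in p, so p is not in the support.
    obtain ⟨x, hx⟩ := DFunLike.ne_iff.1 hφ
    obtain ⟨r, hr⟩ := Ideal.Quotient.mk_surjective (φ x)
    have hrp : r ∉ p.asIdeal := fun h => hx (by
      rw [← hr, Ideal.Quotient.eq_zero_iff_mem.2 h, LinearMap.zero_apply])
    have hann : r ∈ Module.annihilator R ((R ⧸ p.asIdeal) ⧸ J) := by
      rw [Module.mem_annihilator]
      intro y
      obtain ⟨y, rfl⟩ := J.mkQ_surjective y
      obtain ⟨s, rfl⟩ := Ideal.Quotient.mk_surjective y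
      rw [← map_smul, Submodule.mkQ_apply, Submodule.Quotient.mk_eq_zero]
      refine ⟨s • x, ?_⟩
      rw [map_smul, ← hr, Algebra.smul_def, Algebra.smul_def, mul_comm]
      rfl
    exact hrp (Module.annihilator_le_of_mem_support hq hann)
  exact (isCohomological_genFunctor I R).subsingleton_X₂ hS i

/-- The cohomological dimension of a finitely generated module depends only on its support, and is
monotone in it. -/
theorem subsingleton_locCohomology_of_support_subset (I : Ideal R) {K : Type u}
    [AddCommGroup K] [Module R K] [Module.Finite R K] (i : ℕ)
    (hK : ∀ j, i ≤ j → Subsingleton (locCohomology I K j)) (L : Type u)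
    [AddCommGroup L] [Module R L] [Module.Finite R L]
    (hL : Module.support R L ⊆ Module.support R K) : Subsingleton (locCohomology I L i) := by
  obtain ⟨B, hB⟩ := exists_bound_locCohomology I
  by_cases hi : B ≤ i
  · exact hB L i hi
  -- All L supported in Supp K are treated at once, because the step in degree j needs vanishing in
  -- degree j + 1 for auxiliary kernels.
  · refine Nat.decreasingInduction' (P := fun j => ∀ (L : Type u) [AddCommGroup L] [Module R L]
      [Module.Finite R L], Module.support R L ⊆ Module.support R K →
        Subsingleton (locCohomology I L j)) (n := B) (m := i) ?_ (by omega) ?_ L hL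
    · intro j _ hij ih L _ _ _ hL
      exact subsingleton_locCohomology_of_support_primes I j L fun p hp =>
        subsingleton_locCohomology_quotient_prime I j ih (hK j hij) p (hL hp)
    · intro L _ _ _ _
      exact hB L B le_rfl

end

/-! ### Vanishing of Ext below the depth -/

section

variable {R : Type u} [CommRing R]

/-- The identity of A^n is a sum of maps factoring through A. -/
theorem subsingleton_extModule_pi (n : ℕ) (A N : Type u) [AddCommGroup A] [Module R A]
    [AddCommGroup N] [Module R N] (i : ℕ) (h : Subsingleton (ExtModule R A N i)) :
    Subsingleton (ExtModule R (Fin n → A) N i) := by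
  refine subsingleton_of_forall_eq 0 fun x => ?_
  have hid : 𝟙 (ModuleCat.of R (Fin n → A)) = ∑ j : Fin n,
      ModuleCat.ofHom (LinearMap.proj (R := R) (φ := fun _ : Fin n => A) j) ≫
        ModuleCat.ofHom (LinearMap.single R (fun _ : Fin n => A) j) := by
    refine ModuleCat.hom_ext (LinearMap.ext fun y => ?_)
    simp only [ModuleCat.hom_sum, ModuleCat.hom_id, ModuleCat.hom_comp, ModuleCat.hom_ofHom,
      LinearMap.sum_apply, LinearMap.comp_apply, LinearMap.id_apply]
    exact (Finset.univ_sum_single y).symm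
  rw [← Abelian.Ext.mk₀_id_comp x, hid, Abelian.Ext.mk₀_sum, Abelian.Ext.sum_comp]
  refine Finset.sum_eq_zero fun j _ => ?_
  rw [← Abelian.Ext.mk₀_comp_mk₀_assoc, Subsingleton.elim (Abelian.Ext.comp
    (Abelian.Ext.mk₀ (ModuleCat.ofHom (LinearMap.single R (fun _ : Fin n => A) j))) x
      (zero_add i)) 0, Abelian.Ext.comp_zero]

section

variable {A B C : Type u} [AddCommGroup A] [Module R A] [AddCommGroup B] [Module R B]
  [AddCommGroup C] [Module R C] {f : A →ₗ[R] B} {g : B →ₗ[R] C} (hf : Function.Injective f)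
  (hg : Function.Surjective g) (hfg : Function.Exact f g) (N : Type u) [AddCommGroup N] [Module R N]
include hf hg hfg

/-- The long exact sequence puts the kernel in the image of Ext^{i-1}(A,N). For i = 0 the condition
on A is vacuous and left exactness of Hom suffices. -/
theorem precomp_extModule_injective (i : ℕ)
    (hA : ∀ j, j + 1 = i → Subsingleton (ExtModule R A N j)) (x : ExtModule R C N i)
    (hx : (Abelian.Ext.mk₀ (ModuleCat.ofHom g)).comp x (zero_add i) = 0) : x = 0 := by
  have hS := shortExact_of_linearMap f g hf hg hfg
  cases i with
  | zero =>
    have := hS.epi_g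
    have h := Abelian.Ext.precomp_mk₀_injective_of_epi (ModuleCat.of R N) (ModuleCat.ofHom g)
    exact (injective_iff_map_eq_zero _).1 h x hx
  | succ i =>
    obtain ⟨y, rfl⟩ := Abelian.Ext.contravariant_sequence_exact₃ hS _ x hx (add_comm 1 i)
    have := hA i rfl
    rw [Subsingleton.elim (α := ExtModule R A N i) y 0, Abelian.Ext.comp_zero]

theorem subsingleton_extModule_quotient (i : ℕ)
    (hA : ∀ j, j + 1 = i → Subsingleton (ExtModule R A N j))
    (hB : Subsingleton (ExtModule R B N i)) : Subsingleton (ExtModule R C N i) :=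
  subsingleton_of_forall_eq 0 fun x =>
    precomp_extModule_injective hf hg hfg N i hA x (Subsingleton.elim _ _)

end

variable [IsNoetherianRing R] (I : Ideal R) (N : Type u) [AddCommGroup N] [Module R N]

/-- If local cohomology vanishes up to degree `i`, then so does `Ext` from finitely generated
modules annihilated by a power of the ideal. -/
theorem subsingleton_extModule_of_locCohomology (i : ℕ)
    (h : ∀ j ≤ i, Subsingleton (locCohomology I N j)) (L : Type u) [AddCommGroup L] [Module R L]
    [Module.Finite R L] (q : ℕ) (hL : ∀ r ∈ I ^ q, ∀ x : L, r • x = 0) :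
    Subsingleton (ExtModule R L N i) := by
  induction i using Nat.strong_induction_on generalizing L q with
  | _ i ih =>
  have ih' : ∀ (A : Type u) [AddCommGroup A] [Module R A] [Module.Finite R A] (q : ℕ),
      (∀ r ∈ I ^ q, ∀ x : A, r • x = 0) → ∀ j, j + 1 = i → Subsingleton (ExtModule R A N j) :=
    fun A _ _ _ q hA j hj => ih j (by omega) (fun k hk => h k (by omega)) A q hA
  have hquot : ∀ (p : ℕ), ∀ r ∈ I ^ p, ∀ x : R ⧸ (I ^ p • ⊤ : Submodule R R), r • x = 0 := by
    intro p r hr x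
    obtain ⟨x, rfl⟩ := Submodule.mkQ_surjective _ x
    rw [← map_smul]
    exact (Submodule.Quotient.mk_eq_zero _).2 (Submodule.smul_mem_smul hr Submodule.mem_top)
  -- The kernel of R/I^q → R/I^p is killed by I^q, so its Ext^{i-1} vanishes by induction and the
  -- transition maps are injective. Thus Ext^i(R/I^q,N) embeds in H^i_I(N) = 0.
  have htrans : ∀ p q (hpq : p ≤ q) (x : ExtModule R (R ⧸ (I ^ p • ⊤ : Submodule R R)) N i),
      transition I R N i p q hpq x = 0 → x = 0 := by
    intro p q hpq x hx
    have hg : Function.Surjective (Submodule.factorPow I R hpq) :=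
      Submodule.factor_surjective _
    exact precomp_extModule_injective (Submodule.injective_subtype _) hg
      (LinearMap.exact_subtype_ker_map _) N i
      (ih' _ q fun r hr y => Subtype.ext (hquot q r hr y.1)) x hx
  have hR : Subsingleton (ExtModule R (R ⧸ (I ^ q • ⊤ : Submodule R R)) N i) := by
    refine subsingleton_of_forall_eq 0 fun x => ?_
    have := h i le_rfl
    obtain ⟨p, hp, hx⟩ := Module.DirectLimit.of.zero_exact (f := transition I R N i)
      (Subsingleton.elim (Module.DirectLimit.of R ℕ _ (transition I R N i) q x) 0)
    exact htrans q p hp x hx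
  obtain ⟨n, π, hπ⟩ := Module.Finite.exists_fin' R L
  have hker : ∀ r ∈ (I ^ q • ⊤ : Submodule R R), ∀ x : L, r • x = 0 := fun r hr =>
    hL r (by simpa using hr)
  -- Being killed by I^q, L is a quotient of some (R/I^q)^n, with kernel also killed by I^q.
  let ρ : (Fin n → R ⧸ (I ^ q • ⊤ : Submodule R R)) →ₗ[R] L :=
    LinearMap.lsum R (fun _ => R ⧸ (I ^ q • ⊤ : Submodule R R)) R fun j =>
      Submodule.liftQ _ (LinearMap.toSpanSingleton R L (π (Pi.single j 1))) fun r hr =>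
        hker r hr _
  have hρ : Function.Surjective ρ := fun y => by
    obtain ⟨v, rfl⟩ := hπ y
    refine ⟨fun j => Submodule.mkQ _ (v j), ?_⟩
    have hv : π v = ∑ j, π (Pi.single j (v j)) := by rw [← map_sum, Finset.univ_sum_single]
    simp only [ρ, LinearMap.lsum_apply, LinearMap.sum_apply, hv]
    refine Finset.sum_congr rfl fun j _ => ?_
    have hj : Pi.single j (v j) = v j • (Pi.single j 1 : Fin n → R) := by
      rw [← Pi.single_smul, smul_eq_mul, mul_one]
    rw [hj, map_smul]
    rfl
  exact subsingleton_extModule_quotient (Submodule.injective_subtype _) hρ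
    (LinearMap.exact_subtype_ker_map ρ) N i
    (ih' _ q fun r hr y => Subtype.ext (funext fun j => hquot q r hr (y.1 j)))
    (subsingleton_extModule_pi n _ N i hR)

theorem subsingleton_genLocalCohomology_of_locCohomology (M : Type u) [AddCommGroup M] [Module R M]
    [Module.Finite R M] (i : ℕ) (h : ∀ j ≤ i, Subsingleton (locCohomology I N j)) :
    Subsingleton (genLocalCohomology I M N i) :=
  subsingleton_genLocalCohomology I M N i fun q =>
    subsingleton_extModule_of_locCohomology I N i h _ q fun r hr x => by
      obtain ⟨x, rfl⟩ := Submodule.mkQ_surjective _ x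
      rw [← map_smul]
      exact (Submodule.Quotient.mk_eq_zero _).2 (Submodule.smul_mem_smul hr Submodule.mem_top)

end

/-! ### Support of Ext and the inequalities -/

section

variable {R : Type u} [CommRing R]

/-- The fibre of M ⊗ N at p is a tensor product of two nonzero vector spaces over the residue field.
-/
theorem mem_support_tensorProduct (M N : Type u) [AddCommGroup M] [Module R M] [Module.Finite R M]
    [AddCommGroup N] [Module R N] [Module.Finite R N] (p : PrimeSpectrum R)
    (hM : p ∈ Module.support R M) (hN : p ∈ Module.support R N) :
    p ∈ Module.support R (M ⊗[R] N) := by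
  rw [Module.mem_support_iff_nontrivial_residueField_tensorProduct] at hM hN ⊢
  have e := TensorProduct.AlgebraTensorModule.distribBaseChange R p.asIdeal.ResidueField M N
  exact e.toEquiv.nontrivial

theorem smul_extModule_eq_zero_of_left (M N : Type u) [AddCommGroup M] [Module R M]
    [AddCommGroup N] [Module R N] (i : ℕ) (r : R) (h : ∀ m : M, r • m = 0)
    (x : ExtModule R M N i) : r • x = 0 := by
  have hr : r • 𝟙 (ModuleCat.of R M) = 0 := ModuleCat.hom_ext (LinearMap.ext h)
  rw [← Abelian.Ext.mk₀_id_comp x, ← Abelian.Ext.smul_comp, ← Abelian.Ext.mk₀_smul, hr,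
    Abelian.Ext.mk₀_zero, Abelian.Ext.zero_comp]

theorem smul_extModule_eq_zero_of_right (M N : Type u) [AddCommGroup M] [Module R M]
    [AddCommGroup N] [Module R N] (i : ℕ) (r : R) (h : ∀ y : N, r • y = 0)
    (x : ExtModule R M N i) : r • x = 0 := by
  have hr : r • 𝟙 (ModuleCat.of R N) = 0 := ModuleCat.hom_ext (LinearMap.ext h)
  rw [← Abelian.Ext.comp_mk₀_id x, ← Abelian.Ext.comp_smul, ← Abelian.Ext.mk₀_smul, hr,
    Abelian.Ext.mk₀_zero, Abelian.Ext.comp_zero]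

/-- Ext is killed by the annihilators of both M and N, which cut out the supports of these finitely
generated modules. -/
theorem support_extModule_subset (M N : Type u) [AddCommGroup M] [Module R M] [Module.Finite R M]
    [AddCommGroup N] [Module R N] [Module.Finite R N] (i : ℕ) :
    Module.support R (ExtModule R M N i) ⊆ Module.support R (M ⊗[R] N) := fun p hp => by
  have h := Module.annihilator_le_of_mem_support hp
  refine mem_support_tensorProduct M N p ?_ ?_ <;>
    refine Module.mem_support_iff_of_finite.2 (le_trans (fun r hr => ?_) h) <;>
    rw [Module.mem_annihilator] at hr ⊢
  · exact smul_extModule_eq_zero_of_left M N i r hr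
  · exact smul_extModule_eq_zero_of_right M N i r hr

theorem coe_add_le_of_le {a b : WithBot ℕ∞} {p q n : ℕ} (h : p + q = n)
    (ha : ((p : ℕ∞) : WithBot ℕ∞) ≤ a) (hb : ((q : ℕ∞) : WithBot ℕ∞) ≤ b) :
    ((n : ℕ∞) : WithBot ℕ∞) ≤ a + b := by
  rw [← h, Nat.cast_add, WithBot.coe_add]
  exact add_le_add ha hb

variable [IsNoetherianRing R] (I : Ideal R) (M N : Type u) [AddCommGroup M] [Module R M]
  [Module.Finite R M] [AddCommGroup N] [Module R N]

theorem depth_le_depthPair : depth I N ≤ depthPair I M N :=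
  le_iInf₂ fun i hi => by
    by_contra! h
    refine not_subsingleton_iff_nontrivial.2 hi
      (subsingleton_genLocalCohomology_of_locCohomology I N M i fun j hj => ?_)
    refine not_nontrivial_iff_subsingleton.1 fun hj' => h.not_ge ?_
    exact (iInf₂_le j hj').trans (by exact_mod_cast hj)

omit [IsNoetherianRing R] [Module.Finite R M] in
theorem depthPair_le_cdPair (h : ∃ i : ℕ, Nontrivial (genLocalCohomology I M N i)) :
    depthPair I M N ≤ cdPair I M N := by
  obtain ⟨i, hi⟩ := h
  exact (iInf₂_le i hi).trans (le_iSup₂ (f := fun (i : ℕ)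
    (_ : Nontrivial (genLocalCohomology I M N i)) => ((i : ℕ∞) : WithBot ℕ∞)) i hi)

theorem cdPair_le_cd_add_hSup : cdPair I M N ≤ cd I N + hSup I M N :=
  iSup₂_le fun n hn => by
    obtain ⟨p, q, hpq, h⟩ : ∃ p q, p + q = n ∧
        Nontrivial (ExtModule R M (locCohomology I N q) p) := by
      by_contra! h
      exact not_subsingleton_iff_nontrivial.2 hn (subsingleton_of_ext_locCohomology I M N n
        fun p q hpq => h p q hpq)
    have hq : Nontrivial (locCohomology I N q) := by
      rw [← not_subsingleton_iff_nontrivial]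
      intro h'
      exact not_subsingleton_iff_nontrivial.2 h
        (subsingleton_extModule_of_subsingleton M (locCohomology I N q) p)
    refine coe_add_le_of_le ((add_comm q p).trans hpq) (le_iSup₂ (f := fun (i : ℕ)
      (_ : Nontrivial (locCohomology I N i)) => ((i : ℕ∞) : WithBot ℕ∞)) q hq) ?_
    refine le_trans ?_ (le_iSup (fun q => extSup R M (locCohomology I N q)) q)
    exact le_iSup₂ (f := fun (i : ℕ) (_ : Nontrivial (ExtModule R M (locCohomology I N q) i)) =>
      ((i : ℕ∞) : WithBot ℕ∞)) p h

theorem coe_le_cd_of_support_subset {K L : Type u} [AddCommGroup K] [Module R K] [Module.Finite R K]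
    [AddCommGroup L] [Module R L] [Module.Finite R L]
    (h : Module.support R L ⊆ Module.support R K) : cd I L ≤ cd I K :=
  iSup₂_le fun i hi => by
    -- The comparison needs vanishing for K in all degrees ≥ i, so its contrapositive yields a
    -- nonzero degree j ≥ i, not i itself.
    obtain ⟨j, hj, hj'⟩ : ∃ j, i ≤ j ∧ Nontrivial (locCohomology I K j) := by
      by_contra! h'
      exact not_subsingleton_iff_nontrivial.2 hi (subsingleton_locCohomology_of_support_subset I i
        (fun j hj => h' j hj) L h)
    have hij : ((i : ℕ∞) : WithBot ℕ∞) ≤ ((j : ℕ∞) : WithBot ℕ∞) := by exact_mod_cast hj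
    exact hij.trans (le_iSup₂ (f := fun (i : ℕ)
      (_ : Nontrivial (locCohomology I K i)) => ((i : ℕ∞) : WithBot ℕ∞)) j hj')

theorem cdPair_le_cd_tensorProduct_add_extSup [Module.Finite R N] :
    cdPair I M N ≤ cd I (M ⊗[R] N) + extSup R M N :=
  iSup₂_le fun n hn => by
    obtain ⟨p, q, hpq, h⟩ : ∃ p q, p + q = n ∧
        Nontrivial (locCohomology I (ExtModule R M N q) p) := by
      by_contra! h
      exact not_subsingleton_iff_nontrivial.2 hn (subsingleton_of_locCohomology_ext I M N n
        fun p q hpq => h p q hpq)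
    have hq : Nontrivial (ExtModule R M N q) := by
      rw [← not_subsingleton_iff_nontrivial]
      intro h'
      exact not_subsingleton_iff_nontrivial.2 h
        (subsingleton_genLocalCohomology_of_subsingleton I R (ExtModule R M N q) p)
    refine coe_add_le_of_le hpq (le_trans ?_ (coe_le_cd_of_support_subset I
      (support_extModule_subset M N q))) ?_
    · exact le_iSup₂ (f := fun (i : ℕ) (_ : Nontrivial (locCohomology I (ExtModule R M N q) i)) =>
        ((i : ℕ∞) : WithBot ℕ∞)) p h
    · exact le_iSup₂ (f := fun (i : ℕ) (_ : Nontrivial (ExtModule R M N i)) =>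
        ((i : ℕ∞) : WithBot ℕ∞)) q hq

end

end GenLocalCohomology

end

theorem corollary2p5 {R : Type u} [CommRing R] [IsNoetherianRing R] (I : Ideal R)
    (M N : Type u) [AddCommGroup M] [Module R M] [Module.Finite R M]
    [AddCommGroup N] [Module R N] [Module.Finite R N] :
    GenLocalCohomology.depth I N ≤ GenLocalCohomology.depthPair I M N ∧
    ((∃ i : ℕ, Nontrivial (GenLocalCohomology.genLocalCohomology I M N i)) →
      GenLocalCohomology.depthPair I M N ≤ GenLocalCohomology.cdPair I M N) ∧
    GenLocalCohomology.cdPair I M N ≤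
      min (GenLocalCohomology.cd I (M ⊗[R] N) + GenLocalCohomology.extSup R M N)
        (GenLocalCohomology.cd I N + GenLocalCohomology.hSup I M N) :=
  ⟨GenLocalCohomology.depth_le_depthPair I M N, GenLocalCohomology.depthPair_le_cdPair I M N,
    le_min (GenLocalCohomology.cdPair_le_cd_tensorProduct_add_extSup I M N)
      (GenLocalCohomology.cdPair_le_cd_add_hSup I M N)⟩
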